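/- Fix $r>0$ and $C>0$. For each dimension $d$ let $k=k_d\ge 0$ and $\sigma=\sigma_d>0$ be parameters, defined for all large $d$, for which $$\pi_{\mathbf 0}(z)\;\propto\;\|z\|_\infty^{-k}\exp\!\Big(-\frac{\|z\|_\infty^2}{2\sigma^2}\Big),\qquad z\in\mathbb R^d,$$ is a probability density. Assume: 1) $\|z\|_\infty$ is stochastically bounded as $d\to\infty$: for every $\eta>0$ there is a finite $M>0$ with $\mathrm P_{z\sim\pi_{\mathbf 0}}(\|z\|_\infty>M)\le\eta$ for all sufficiently large $d$; 2) for all sufficiently large $d$ the mode of $\|z\|_\infty$ under $\pi_{\mathbf 0}$ (the point where its probability density is maximal) equals $Cr$. Notation: $\mathcal F_{[0,1]}$ is the set of measurable $f:\mathbb R^d\to[0,1]$; $\mathcal B=\{\delta\in\mathbb R^d:\|\delta\|_\infty\le r\}$; $\pi_\delta$ is the law of $z+\delta$ for $z\sim\pi_{\mathbf 0}$; $f_{\pi_{\mathbf 0}}(x)=\mathbb E_{z\sim\pi_{\mathbf 0}}f(x+z)$. For $x\in\mathbb R^d$ and $\lambda\ge0$, $$\mathbb D(\lambda\pi_{\mathbf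 0}\|\pi_\delta)=\sup_{f\in\mathcal F_{[0,1]}}\big\{\lambda\,\mathbb E_{z\sim\pi_{\mathbf 0}}f(x+z)-\mathbb E_{z\sim\pi_\delta}f(x+z)\big\},$$ and for a given classifier $f^\sharp\in\mathcal F_{[0,1]}$ the certification bound at $x$ is $$\mathcal L=\inf\big\{f_{\pi_{\mathbf 0}}(x+\delta):f\in\mathcal F_{[0,1]},\ \delta\in\mathcal B,\ f_{\pi_{\mathbf 0}}(x)=f^\sharp_{\pi_{\mathbf 0}}(x)\big\};$$ the classifier is certified at $x$ when $\mathcal L>1/2$. Then for every $\varepsilon\in(0,1)$ there are a constant $t>1$ and a dimension $d_0$ such that: (a) for every $\lambda\ge0$ there is a constant $K$ such that for all $d\ge d_0$ and all $x\in\mathbb R^d$ $$\sup_{\delta\in\mathcal B}\mathbb D(\lambda\pi_{\mathbf 0}\|\pi_\delta)\;\ge\;(1-\varepsilon)\big(\lambda-K\,t^{-d}\big);$$ (b) there is a constant $K$ such that for all $d\ge d_0$, all $x\in\mathbb R^d$ and all $f^\sharp\in\mathcal F_{[0,1]}$ with $f^\sharp_{\pi_{\mathbf 0}}(x)\le1-\varepsilon$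 one has $\mathcal L\le K\,t^{-d}$ and $\mathcal L<1/2$, so that certification fails. Moreover, for every $\lambda\ge0$ and every choice of points $x=x_d\in\mathbb R^d$, $\sup_{\delta\in\mathcal B}\mathbb D(\lambda\pi_{\mathbf 0}\|\pi_\delta)\to\lambda$ as $d\to\infty$. -/

import Mathlib

open MeasureTheory Filter Topology
open scoped ENNReal

namespace Smoothing

/-- The unnormalised density `‖z‖_∞^{-k} exp(-‖z‖_∞² / (2σ²))` on `ℝ^d`.
The norm of `Fin d → ℝ` in Mathlib is the sup norm, i.e. the `ℓ_∞` norm. -/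
noncomputable def unnormalizedDensity (d : ℕ) (k σ : ℝ) (z : Fin d → ℝ) : ℝ :=
  ‖z‖ ^ (-k) * Real.exp (-‖z‖ ^ 2 / (2 * σ ^ 2))

/-- The smoothing distribution `π_0` on `ℝ^d`: the normalised measure whose Lebesgue density is
proportional to `‖z‖_∞^{-k} exp(-‖z‖_∞² / (2σ²))`. -/
noncomputable def smoothingMeasure (d : ℕ) (k σ : ℝ) : Measure (Fin d → ℝ) :=
  (∫⁻ z, ENNReal.ofReal (unnormalizedDensity d k σ z))⁻¹ •
    (volume : Measure (Fin d → ℝ)).withDensity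
      (fun z => ENNReal.ofReal (unnormalizedDensity d k σ z))

/-- `c` is a mode of the law `ν` on `ℝ`: `ν` has a Lebesgue density that is continuous at `c` and
takes its maximum over `ℝ` at `c`. (Continuity at `c` makes the value of the density at `c`
independent of the chosen version.) -/
def IsMode (ν : Measure ℝ) (c : ℝ) : Prop :=
  ∃ p : ℝ → ℝ, Measurable p ∧ (∀ x, 0 ≤ p x) ∧
    ν = (volume : Measure ℝ).withDensity (fun x => ENNReal.ofReal (p x)) ∧
    ContinuousAt p c ∧ ∀ x, p x ≤ p c

/-- The class `F_[0,1]` of (measurable) functions on `ℝ^d` with values in `[0,1]`. -/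
def unitFunctions (d : ℕ) : Set ((Fin d → ℝ) → ℝ) :=
  {f | Measurable f ∧ ∀ z, f z ∈ Set.Icc (0 : ℝ) 1}

/-- The `ℓ_∞` ball `{δ : ‖δ‖_∞ ≤ r}` of perturbations. -/
def linftyBall (d : ℕ) (r : ℝ) : Set (Fin d → ℝ) := {δ | ‖δ‖ ≤ r}

/-- The smoothed function `f_μ(x) = E_{z ∼ μ}[f(x + z)]`. -/
noncomputable def smoothed {d : ℕ} (μ : Measure (Fin d → ℝ)) (f : (Fin d → ℝ) → ℝ)
    (x : Fin d → ℝ) : ℝ :=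
  ∫ z, f (x + z) ∂μ

/-- The law `π_δ` of `z + δ` when `z ∼ μ`. -/
noncomputable def shifted {d : ℕ} (μ : Measure (Fin d → ℝ)) (δ : Fin d → ℝ) :
    Measure (Fin d → ℝ) :=
  μ.map (fun z => z + δ)

/-- The discrepancy
`D_F(lam μ ‖ ν) = sup_{f ∈ F} { lam E_{z ∼ μ}[f(x + z)] - E_{z ∼ ν}[f(x + z)] }`. -/
noncomputable def discrepancy {d : ℕ} (F : Set ((Fin d → ℝ) → ℝ)) (x : Fin d → ℝ) (lam : ℝ)
    (μ ν : Measure (Fin d → ℝ)) : ℝ :=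
  sSup ((fun f => lam * smoothed μ f x - smoothed ν f x) '' F)

/-- The maximal discrepancy `sup_{δ ∈ B} D_F(lam μ ‖ μ_δ)`. -/
noncomputable def maxDiscrepancy {d : ℕ} (F : Set ((Fin d → ℝ) → ℝ)) (B : Set (Fin d → ℝ))
    (x : Fin d → ℝ) (lam : ℝ) (μ : Measure (Fin d → ℝ)) : ℝ :=
  sSup ((fun δ => discrepancy F x lam μ (shifted μ δ)) '' B)

/-- The certification bound
`L_μ(F, B) = inf_{f ∈ F} inf_{δ ∈ B} { f_μ(x + δ) : f_μ(x) = g_μ(x) }`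
for the given classifier `g` at the point `x`. -/
noncomputable def certificationBound {d : ℕ} (F : Set ((Fin d → ℝ) → ℝ))
    (B : Set (Fin d → ℝ)) (μ : Measure (Fin d → ℝ)) (g : (Fin d → ℝ) → ℝ)
    (x : Fin d → ℝ) : ℝ :=
  sInf {v | ∃ f ∈ F, ∃ δ ∈ B, smoothed μ f x = smoothed μ g x ∧ v = smoothed μ f (x + δ)}

end Smoothing

namespace Smoothing

/-! Shift along the diagonal, δ = (r, …, r), and test with the points of norm at most M that are
closer to 0 than to δ. Every failure to separate constrains all coordinates at once: if z + δ lies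
in this set, then z i + r ≤ ‖z‖ for every i; if ‖z‖ ≤ M and z misses it, then r - z i ≤ ‖z‖ for
every i. Within the cube of radius R such z lie in a box of side 2R - r, a fraction (1 - r/(2R))^d
of the cube. Since the density decreases in the norm, π₀ is a mixture of uniform laws on centred
cubes, and the fraction becomes an exponentially small mass (`smoothingMeasure_real_le`). Stochastic
boundedness supplies M independent of d.

The indicator of the set is the test function for the discrepancy (`le_maxDiscrepancy`); a multiple
of it is the adversarial classifier (`certificationBound_le`). -/

lemma unnormalizedDensity_nonneg (d : ℕ) (k σ : ℝ) (z : Fin d → ℝ) :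
    0 ≤ unnormalizedDensity d k σ z := by
  unfold unnormalizedDensity; positivity

lemma measurable_unnormalizedDensity (d : ℕ) (k σ : ℝ) :
    Measurable (unnormalizedDensity d k σ) := by
  unfold unnormalizedDensity
  fun_prop

/-- The density is a decreasing function of the norm, away from the origin. -/
lemma unnormalizedDensity_le {d : ℕ} {k σ : ℝ} (hk : 0 ≤ k) {y z : Fin d → ℝ}
    (hy : 0 < ‖y‖) (hyz : ‖y‖ ≤ ‖z‖) :
    unnormalizedDensity d k σ z ≤ unnormalizedDensity d k σ y := by
  unfold unnormalizedDensity
  have h1 : ‖z‖ ^ (-k) ≤ ‖y‖ ^ (-k) :=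
    Real.rpow_le_rpow_of_nonpos hy hyz (by linarith)
  gcongr

/-! ### Mass bounds for densities decreasing in the sup norm -/

/-- A set that contains, with each point, all nonzero points of smaller norm is, up to null sets,
a cube. If `G` lies in the cube of radius `M` and occupies at most the fraction of a cube with side
shortened by `r` in each cube, then it occupies an exponentially small fraction of the set. -/
lemma volume_inter_le_of_lower {d : ℕ} (hd : 0 < d) {r M : ℝ} (hr : 0 < r) (hM : r ≤ M)
    {G V : Set (Fin d → ℝ)} (hGM : ∀ z ∈ G, ‖z‖ ≤ M)
    (hG : ∀ R : ℝ, volume (G ∩ Metric.closedBall 0 R) ≤ ENNReal.ofReal (2 * R - r) ^ d)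
    (hV : ∀ z ∈ V, ∀ y : Fin d → ℝ, 0 < ‖y‖ → ‖y‖ ≤ ‖z‖ → y ∈ V) :
    volume (G ∩ V) ≤ ENNReal.ofReal ((1 - r / (4 * M)) ^ d) * volume V := by
  have : Nonempty (Fin d) := ⟨⟨0, hd⟩⟩
  have hMpos : 0 < M := by linarith
  have hq : 3 / 4 ≤ 1 - r / (4 * M) := by
    have : r / (4 * M) ≤ 1 / 4 := by
      rw [div_le_div_iff₀ (by positivity) (by norm_num)]; linarith
    linarith
  -- The origin is excluded because `0 ^ (-k) = 0` for k > 0, so a superlevel set may miss it.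
  have hball : ∀ R : ℝ, 0 < R → Metric.ball (0 : Fin d → ℝ) R \ {0} ⊆ V →
      ENNReal.ofReal ((2 * R) ^ d) ≤ volume V := by
    intro R hR hsub
    calc ENNReal.ofReal ((2 * R) ^ d) = volume (Metric.ball (0 : Fin d → ℝ) R) := by
          rw [Real.volume_pi_ball _ hR, Fintype.card_fin]
      _ = volume (Metric.ball (0 : Fin d → ℝ) R \ {0}) :=
          (measure_sdiff_null (measure_singleton _)).symm
      _ ≤ volume V := measure_mono hsub
  -- If V reaches beyond 2M, it fills the cube of radius 2M while G stays in radius M: the ratio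
  -- 2^(-d) is below (3/4)^d. Otherwise V is a cube of radius R ≤ 2M up to null sets, and 1 - r/(2R)
  -- ≤ 1 - r/(4M).
  by_cases hlarge : ∃ z ∈ V, 2 * M < ‖z‖
  · obtain ⟨z, hz, hzM⟩ := hlarge
    have h1 := hball (2 * M) (by positivity) (by
      rintro y ⟨hy, hy0⟩
      rw [mem_ball_zero_iff] at hy
      exact hV z hz y (norm_pos_iff.2 hy0) (by linarith))
    calc volume (G ∩ V) ≤ volume (Metric.closedBall (0 : Fin d → ℝ) M) :=
          measure_mono fun y hy => mem_closedBall_zero_iff.2 (hGM y hy.1)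
      _ = ENNReal.ofReal ((2 * M) ^ d) := by
          rw [Real.volume_pi_closedBall _ hMpos.le, Fintype.card_fin]
      _ ≤ ENNReal.ofReal ((1 - r / (4 * M)) ^ d) * ENNReal.ofReal ((2 * (2 * M)) ^ d) := by
          rw [← ENNReal.ofReal_mul (by apply pow_nonneg; linarith), ← mul_pow]
          apply ENNReal.ofReal_le_ofReal
          apply pow_le_pow_left₀ (by positivity)
          nlinarith
      _ ≤ _ := by gcongr
  · push Not at hlarge
    set R := sSup (norm '' V) with hR
    have hbdd : BddAbove (norm '' V) := ⟨2 * M, by rintro _ ⟨z, hz, rfl⟩; exact hlarge z hz⟩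
    have hR2 : R ≤ 2 * M :=
      Real.sSup_le (by rintro _ ⟨z, hz, rfl⟩; exact hlarge z hz) (by positivity)
    have hle : volume (G ∩ V) ≤ ENNReal.ofReal (2 * R - r) ^ d := by
      have hsub : G ∩ V ⊆ G ∩ Metric.closedBall 0 R := fun z hz =>
        ⟨hz.1, mem_closedBall_zero_iff.2 (le_csSup hbdd ⟨z, hz.2, rfl⟩)⟩
      exact (measure_mono hsub).trans (hG R)
    -- The degenerate case includes empty V, where `sSup` gives R = 0.
    rcases le_or_gt (2 * R - r) 0 with h0 | h0
    · rw [ENNReal.ofReal_eq_zero.2 h0, zero_pow hd.ne'] at hle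
      exact hle.trans zero_le
    have hRpos : 0 < R := by linarith
    have h1 := hball R hRpos (by
      rintro y ⟨hy, hy0⟩
      rw [mem_ball_zero_iff] at hy
      have hne : (norm '' V).Nonempty := by
        by_contra hne
        rw [Set.not_nonempty_iff_eq_empty] at hne
        rw [hR, hne, Real.sSup_empty] at hRpos
        exact lt_irrefl _ hRpos
      obtain ⟨_, ⟨z, hz, rfl⟩, hyz⟩ := exists_lt_of_lt_csSup hne hy
      exact hV z hz y (norm_pos_iff.2 hy0) hyz.le)
    calc volume (G ∩ V) ≤ ENNReal.ofReal ((2 * R - r) ^ d) := by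
          rwa [ENNReal.ofReal_pow h0.le]
      _ ≤ ENNReal.ofReal ((1 - r / (4 * M)) ^ d) * ENNReal.ofReal ((2 * R) ^ d) := by
          rw [← ENNReal.ofReal_mul (by apply pow_nonneg; linarith), ← mul_pow]
          apply ENNReal.ofReal_le_ofReal
          apply pow_le_pow_left₀ h0.le
          have : r / (4 * M) * (2 * R) ≤ r := by
            rw [div_mul_eq_mul_div, div_le_iff₀ (by positivity)]
            nlinarith
          linarith
      _ ≤ _ := by gcongr

/-- The smoothing distribution gives exponentially small mass to a bounded set that occupies at
most the fraction of a cube with side shortened by `r` in each cube. -/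
lemma smoothingMeasure_real_le {d : ℕ} (hd : 0 < d) {k σ : ℝ} (hk : 0 ≤ k)
    [IsProbabilityMeasure (smoothingMeasure d k σ)] {r M : ℝ} (hr : 0 < r) (hM : r ≤ M)
    {G : Set (Fin d → ℝ)} (hGmeas : MeasurableSet G) (hGM : ∀ z ∈ G, ‖z‖ ≤ M)
    (hG : ∀ R : ℝ, volume (G ∩ Metric.closedBall 0 R) ≤ ENNReal.ofReal (2 * R - r) ^ d) :
    (smoothingMeasure d k σ).real G ≤ (1 - r / (4 * M)) ^ d := by
  have hMpos : 0 < M := by linarith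
  have hq : 0 ≤ 1 - r / (4 * M) := by
    have : r / (4 * M) ≤ 1 := by
      rw [div_le_one (by positivity)]; linarith
    linarith
  have hmeas := measurable_unnormalizedDensity d k σ
  set θ := ENNReal.ofReal ((1 - r / (4 * M)) ^ d) with hθ
  -- Layer cake: it suffices to compare G with each superlevel set.
  have hlc : ∀ ν : Measure (Fin d → ℝ),
      ∫⁻ z, ENNReal.ofReal (unnormalizedDensity d k σ z) ∂ν
        = ∫⁻ t in Set.Ioi 0, ν {z | t < unnormalizedDensity d k σ z} := fun ν =>
    lintegral_eq_lintegral_meas_lt ν (ae_of_all _ (unnormalizedDensity_nonneg d k σ))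
      hmeas.aemeasurable
  have key : ∫⁻ z in G, ENNReal.ofReal (unnormalizedDensity d k σ z)
      ≤ θ * ∫⁻ z, ENNReal.ofReal (unnormalizedDensity d k σ z) := by
    rw [hlc, hlc, ← lintegral_const_mul' _ _ ENNReal.ofReal_ne_top]
    refine lintegral_mono fun t => ?_
    rw [Measure.restrict_apply (measurableSet_lt measurable_const hmeas), Set.inter_comm]
    refine volume_inter_le_of_lower hd hr hM hGM hG fun z hz y hy hyz => ?_
    exact lt_of_lt_of_le hz (unnormalizedDensity_le hk hy hyz)
  have hle : smoothingMeasure d k σ G ≤ θ := by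
    calc smoothingMeasure d k σ G
        = (∫⁻ z, ENNReal.ofReal (unnormalizedDensity d k σ z))⁻¹ *
            ∫⁻ z in G, ENNReal.ofReal (unnormalizedDensity d k σ z) := by
          rw [smoothingMeasure, Measure.smul_apply, withDensity_apply _ hGmeas, smul_eq_mul]
      _ ≤ (∫⁻ z, ENNReal.ofReal (unnormalizedDensity d k σ z))⁻¹ *
            (θ * ∫⁻ z, ENNReal.ofReal (unnormalizedDensity d k σ z)) := by gcongr
      _ = θ * smoothingMeasure d k σ Set.univ := by
          rw [smoothingMeasure, Measure.smul_apply, withDensity_apply _ MeasurableSet.univ,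
            smul_eq_mul, Measure.restrict_univ]
          ring
      _ = θ := by rw [measure_univ, mul_one]
  exact ENNReal.toReal_le_of_le_ofReal (pow_nonneg hq d) hle

/-- Inside the cube, the one-sided constraint cuts every coordinate interval to [-R, R - r] or [r -
R, R]. -/
lemma volume_shrunk_inter_closedBall_le {d : ℕ} {r R : ℝ} {G : Set (Fin d → ℝ)}
    (hG : (∀ z ∈ G, ∀ i, z i + r ≤ ‖z‖) ∨ (∀ z ∈ G, ∀ i, r - z i ≤ ‖z‖)) :
    volume (G ∩ Metric.closedBall 0 R) ≤ ENNReal.ofReal (2 * R - r) ^ d := by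
  have hcube : ∀ a b : ℝ, b - a = 2 * R - r →
      volume (Set.Icc (fun _ : Fin d => a) (fun _ => b)) = ENNReal.ofReal (2 * R - r) ^ d := by
    intro a b hab
    simp [Real.volume_Icc_pi, hab]
  have hcoord : ∀ z ∈ Metric.closedBall (0 : Fin d → ℝ) R, ∀ i, |z i| ≤ R ∧ ‖z‖ ≤ R := by
    intro z hz i
    rw [mem_closedBall_zero_iff] at hz
    exact ⟨(norm_le_pi_norm z i).trans hz, hz⟩
  rcases hG with hG | hG
  · rw [← hcube (-R) (R - r) (by ring)]
    refine measure_mono fun z hz => ⟨fun i => ?_, fun i => ?_⟩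
    · exact (abs_le.1 (hcoord z hz.2 i).1).1
    · have := hG z hz.1 i; have := (hcoord z hz.2 i).2
      show z i ≤ R - r
      linarith
  · rw [← hcube (r - R) R (by ring)]
    refine measure_mono fun z hz => ⟨fun i => ?_, fun i => ?_⟩
    · have := hG z hz.1 i; have := (hcoord z hz.2 i).2
      show r - R ≤ z i
      linarith
    · exact (abs_le.1 (hcoord z hz.2 i).1).2

/-! ### Separation by the diagonal shift -/

/-- The set of points of norm at most `M` that are closer to `0` than to `δ`. -/
def separatingSet {d : ℕ} (M : ℝ) (δ : Fin d → ℝ) : Set (Fin d → ℝ) :=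
  {z | ‖z‖ ≤ M ∧ ‖z‖ < ‖z - δ‖}

lemma measurableSet_separatingSet {d : ℕ} (M : ℝ) (δ : Fin d → ℝ) :
    MeasurableSet (separatingSet M δ) :=
  (measurableSet_le measurable_norm measurable_const).inter
    (measurableSet_lt measurable_norm (by fun_prop))

section Separation

variable {d : ℕ} {k σ r M : ℝ} [IsProbabilityMeasure (smoothingMeasure d k σ)]

/-- The shifted distribution gives exponentially small mass to the separating set. -/
lemma real_preimage_separatingSet_le (hd : 0 < d) (hk : 0 ≤ k) (hr : 0 < r) (hM : 0 ≤ M) :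
    (smoothingMeasure d k σ).real {z | z + (fun _ => r) ∈ separatingSet M (fun _ => r)}
      ≤ (1 - r / (4 * (M + r))) ^ d := by
  refine smoothingMeasure_real_le hd hk hr (by linarith)
    ((measurableSet_separatingSet _ _).preimage (measurable_id.add_const _)) ?_ fun R =>
      volume_shrunk_inter_closedBall_le (Or.inl ?_)
  · rintro z ⟨h1, -⟩
    have : Nonempty (Fin d) := ⟨⟨0, hd⟩⟩
    calc ‖z‖ = ‖(z + fun _ => r) - fun _ => r‖ := by rw [add_sub_cancel_right]
      _ ≤ ‖z + fun _ => r‖ + ‖fun _ : Fin d => r‖ := norm_sub_le _ _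
      _ ≤ M + r := by
        rw [pi_norm_const, Real.norm_of_nonneg hr.le]; gcongr
  · rintro z ⟨-, h2⟩ i
    rw [add_sub_cancel_right] at h2
    exact ((le_abs_self _).trans (norm_le_pi_norm (z + fun _ => r) i)).trans h2.le

/-- The distribution gives almost all of its mass in the ball of radius `M` to the separating
set. -/
lemma le_real_separatingSet (hd : 0 < d) (hk : 0 ≤ k) (hr : 0 < r) (hM : 0 ≤ M) :
    1 - (smoothingMeasure d k σ).real {z | M < ‖z‖} - (1 - r / (4 * (M + r))) ^ d
      ≤ (smoothingMeasure d k σ).real (separatingSet M (fun _ => r)) := by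
  set μ := smoothingMeasure d k σ
  set G : Set (Fin d → ℝ) := {z | ‖z‖ ≤ M ∧ ‖z - fun _ => r‖ ≤ ‖z‖} with hGdef
  have hG : μ.real G ≤ (1 - r / (4 * (M + r))) ^ d := by
    refine smoothingMeasure_real_le hd hk hr (by linarith)
      ((measurableSet_le measurable_norm measurable_const).inter
        (measurableSet_le (by fun_prop) measurable_norm)) ?_ fun R =>
        volume_shrunk_inter_closedBall_le (Or.inr ?_)
    · rintro z ⟨h1, -⟩
      -- Radius M + r is wasteful here, but gives both mass bounds the same base.
      linarith
    · rintro z ⟨-, h2⟩ i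
      have h3 := (neg_le_abs _).trans (norm_le_pi_norm (z - fun _ => r) i)
      simp only [Pi.sub_apply, neg_sub] at h3
      exact h3.trans h2
  have hcov : (Set.univ : Set (Fin d → ℝ)) ⊆
      (separatingSet M (fun _ => r) ∪ {z | M < ‖z‖}) ∪ G := by
    intro z _
    by_cases h1 : ‖z‖ ≤ M
    · rcases lt_or_ge ‖z‖ ‖z - fun _ => r‖ with h2 | h2
      · exact Or.inl (Or.inl ⟨h1, h2⟩)
      · exact Or.inr ⟨h1, h2⟩
    · exact Or.inl (Or.inr (not_le.1 h1))
  have h1 : (1 : ℝ) ≤ μ.real ((separatingSet M (fun _ => r) ∪ {z | M < ‖z‖}) ∪ G) := by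
    rw [← probReal_univ (μ := μ)]
    exact measureReal_mono hcov
  have h2 := measureReal_union_le (μ := μ) (separatingSet M (fun _ => r) ∪ {z | M < ‖z‖}) G
  have h3 := measureReal_union_le (μ := μ) (separatingSet M (fun _ => r)) {z | M < ‖z‖}
  linarith

end Separation

/-! ### Test functions for the discrepancy and the certification bound -/

section Bounds

variable {d : ℕ} {μ : Measure (Fin d → ℝ)} {f : (Fin d → ℝ) → ℝ}

lemma smoothed_nonneg (hf : f ∈ unitFunctions d) (x : Fin d → ℝ) : 0 ≤ smoothed μ f x :=
  integral_nonneg fun z => (hf.2 (x + z)).1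

lemma smoothed_le_one [IsProbabilityMeasure μ] (hf : f ∈ unitFunctions d) (x : Fin d → ℝ) :
    smoothed μ f x ≤ 1 := by
  calc smoothed μ f x ≤ ∫ _, (1 : ℝ) ∂μ :=
        integral_mono_of_nonneg (ae_of_all _ fun z => (hf.2 (x + z)).1) (integrable_const _)
          (ae_of_all _ fun z => (hf.2 (x + z)).2)
    _ = 1 := by simp

lemma smoothed_shifted (hf : Measurable f) (δ x : Fin d → ℝ) :
    smoothed (shifted μ δ) f x = smoothed μ f (x + δ) := by
  unfold smoothed shifted
  have hfx : Measurable fun z => f (x + z) := hf.comp (measurable_const_add x)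
  rw [integral_map (by fun_prop) hfx.aestronglyMeasurable]
  refine integral_congr_ae (ae_of_all _ fun z => ?_)
  simp only [add_assoc, add_comm z δ]

/-- The multiple `c` of the indicator function of the translate `x + A`. -/
noncomputable def scaledIndicator (A : Set (Fin d → ℝ)) (x : Fin d → ℝ) (c : ℝ) :
    (Fin d → ℝ) → ℝ :=
  fun y => A.indicator (fun _ => c) (y - x)

lemma scaledIndicator_mem {A : Set (Fin d → ℝ)} (hA : MeasurableSet A) (x : Fin d → ℝ) {c : ℝ}
    (hc : 0 ≤ c) (hc1 : c ≤ 1) : scaledIndicator A x c ∈ unitFunctions d := by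
  refine ⟨(measurable_const.indicator hA).comp (measurable_id.sub_const x), fun z => ?_⟩
  unfold scaledIndicator
  by_cases h : z - x ∈ A <;> simp [h, hc, hc1]

lemma smoothed_scaledIndicator {A : Set (Fin d → ℝ)} (hA : MeasurableSet A)
    (x δ : Fin d → ℝ) (c : ℝ) :
    smoothed μ (scaledIndicator A x c) (x + δ) = c * μ.real {z | z + δ ∈ A} := by
  have h : ∀ z, scaledIndicator A x c (x + δ + z) = {z | z + δ ∈ A}.indicator (fun _ => c) z := by
    intro z
    have : x + δ + z - x = z + δ := by abel
    rw [scaledIndicator, this]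
    rfl
  simp only [smoothed, h]
  have hA' : MeasurableSet {z | z + δ ∈ A} := hA.preimage (measurable_id.add_const δ)
  rw [integral_indicator_const c hA', smul_eq_mul, mul_comm]

lemma discrepancy_values_le [IsProbabilityMeasure μ] {lam : ℝ} (hlam : 0 ≤ lam)
    (x δ : Fin d → ℝ) (hf : f ∈ unitFunctions d) :
    lam * smoothed μ f x - smoothed (shifted μ δ) f x ≤ lam := by
  have h1 := smoothed_le_one (μ := μ) hf x
  have h2 := smoothed_nonneg (μ := shifted μ δ) hf x
  nlinarith

lemma discrepancy_le [IsProbabilityMeasure μ] {lam : ℝ} (hlam : 0 ≤ lam) (x δ : Fin d → ℝ) :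
    discrepancy (unitFunctions d) x lam μ (shifted μ δ) ≤ lam :=
  Real.sSup_le (by rintro _ ⟨f, hf, rfl⟩; exact discrepancy_values_le hlam x δ hf) hlam

lemma maxDiscrepancy_le [IsProbabilityMeasure μ] {lam : ℝ} (hlam : 0 ≤ lam) (x : Fin d → ℝ)
    (B : Set (Fin d → ℝ)) : maxDiscrepancy (unitFunctions d) B x lam μ ≤ lam :=
  Real.sSup_le (by rintro _ ⟨δ, -, rfl⟩; exact discrepancy_le hlam x δ) hlam

lemma le_maxDiscrepancy [IsProbabilityMeasure μ] {lam : ℝ} (hlam : 0 ≤ lam)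
    (x : Fin d → ℝ) {B : Set (Fin d → ℝ)} {δ : Fin d → ℝ} (hδ : δ ∈ B)
    {A : Set (Fin d → ℝ)} (hA : MeasurableSet A) :
    lam * μ.real A - μ.real {z | z + δ ∈ A} ≤ maxDiscrepancy (unitFunctions d) B x lam μ := by
  have hmem := scaledIndicator_mem hA x zero_le_one le_rfl
  have h0 := smoothed_scaledIndicator (μ := μ) hA x 0 1
  have h1 := smoothed_scaledIndicator (μ := μ) hA x δ 1
  simp only [add_zero, one_mul, Set.ofPred_mem_eq] at h0 h1
  calc lam * μ.real A - μ.real {z | z + δ ∈ A}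
      = lam * smoothed μ (scaledIndicator A x 1) x
          - smoothed (shifted μ δ) (scaledIndicator A x 1) x := by
        rw [smoothed_shifted hmem.1, h0, h1]
    _ ≤ discrepancy (unitFunctions d) x lam μ (shifted μ δ) :=
        le_csSup ⟨lam, by rintro _ ⟨f, hf, rfl⟩; exact discrepancy_values_le hlam x δ hf⟩
          ⟨_, hmem, rfl⟩
    _ ≤ maxDiscrepancy (unitFunctions d) B x lam μ :=
        le_csSup ⟨lam, by rintro _ ⟨δ, -, rfl⟩; exact discrepancy_le hlam x δ⟩ ⟨δ, hδ, rfl⟩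

lemma certificationBound_le {g : (Fin d → ℝ) → ℝ} (hg : g ∈ unitFunctions d) (x : Fin d → ℝ)
    {B : Set (Fin d → ℝ)} {δ : Fin d → ℝ} (hδ : δ ∈ B)
    {A : Set (Fin d → ℝ)} (hA : MeasurableSet A) (hApos : 0 < μ.real A)
    (hgA : smoothed μ g x ≤ μ.real A) :
    certificationBound (unitFunctions d) B μ g x
      ≤ smoothed μ g x / μ.real A * μ.real {z | z + δ ∈ A} := by
  set c := smoothed μ g x / μ.real A
  have hc : 0 ≤ c := div_nonneg (smoothed_nonneg hg x) hApos.le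
  have hc1 : c ≤ 1 := (div_le_one hApos).2 hgA
  have h0 := smoothed_scaledIndicator (μ := μ) hA x 0 c
  simp only [add_zero, Set.ofPred_mem_eq] at h0
  -- The factor c is chosen so that the scaled indicator has exactly the smoothed value of g at x.
  refine csInf_le ⟨0, ?_⟩ ⟨scaledIndicator A x c, scaledIndicator_mem hA x hc hc1, δ, hδ, ?_,
    (smoothed_scaledIndicator hA x δ c).symm⟩
  · rintro v ⟨f, hf, δ, -, -, rfl⟩
    exact smoothed_nonneg hf _
  · rw [h0, div_mul_cancel₀ _ hApos.ne']

end Bounds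

lemma const_mem_linftyBall (d : ℕ) {r : ℝ} (hr : 0 ≤ r) : (fun _ => r) ∈ linftyBall d r :=
  (pi_norm_le_iff_of_nonneg hr).2 fun _ => (Real.norm_of_nonneg hr).le

/-! ### Asymptotics in the dimension -/

/-- Stochastic boundedness gives sets that carry almost all of the mass, while their translates by
a vector in the ball carry exponentially little. -/
lemma exists_separating_sets {r : ℝ} (hr : 0 < r) {k σ : ℕ → ℝ}
    (hparam : ∀ᶠ d in atTop, 0 ≤ k d ∧ 0 < σ d ∧
      IsProbabilityMeasure (smoothingMeasure d (k d) (σ d)))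
    (hbounded : ∀ η : ℝ, 0 < η → ∃ M : ℝ, 0 < M ∧ ∀ᶠ d in atTop,
      (smoothingMeasure d (k d) (σ d)).real {z | M < ‖z‖} ≤ η)
    {ε : ℝ} (hε : 0 < ε) :
    ∃ t : ℝ, 1 < t ∧ ∀ᶠ d in atTop, IsProbabilityMeasure (smoothingMeasure d (k d) (σ d)) ∧
      ∃ A : Set (Fin d → ℝ), MeasurableSet A ∧ ∃ δ ∈ linftyBall d r,
        1 - ε ≤ (smoothingMeasure d (k d) (σ d)).real A ∧
        (smoothingMeasure d (k d) (σ d)).real {z | z + δ ∈ A} ≤ 1 / t ^ d := by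
  obtain ⟨M, hM, hMb⟩ := hbounded (ε / 2) (by positivity)
  set q := 1 - r / (4 * (M + r)) with hq
  have hq1 : q < 1 := by
    have : 0 < r / (4 * (M + r)) := by positivity
    linarith
  have hq0 : 0 < q := by
    have : r / (4 * (M + r)) < 1 := by rw [div_lt_one (by positivity)]; linarith
    linarith
  have hqlim : ∀ᶠ d : ℕ in atTop, q ^ d < ε / 2 :=
    (tendsto_pow_atTop_nhds_zero_of_lt_one hq0.le hq1).eventually_lt_const (by positivity)
  refine ⟨q⁻¹, (one_lt_inv₀ hq0).2 hq1, ?_⟩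
  filter_upwards [hparam, hMb, hqlim, eventually_gt_atTop 0] with d ⟨hk, _, hprob⟩ hMd hqd hd
  refine ⟨hprob, separatingSet M (fun _ => r), measurableSet_separatingSet _ _, fun _ => r,
    const_mem_linftyBall d hr.le, ?_, ?_⟩
  · have := le_real_separatingSet (σ := σ d) hd hk hr hM.le
    linarith
  · rw [inv_pow, one_div, inv_inv]
    exact real_preimage_separatingSet_le hd hk hr hM.le

end Smoothing

theorem mainTheorem9 (r C : ℝ) (hr : 0 < r) (hC : 0 < C) (k σ : ℕ → ℝ)
    (hparam : ∀ᶠ d in atTop, 0 ≤ k d ∧ 0 < σ d ∧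
      IsProbabilityMeasure (Smoothing.smoothingMeasure d (k d) (σ d)))
    (hbounded : ∀ η : ℝ, 0 < η → ∃ M : ℝ, 0 < M ∧ ∀ᶠ d in atTop,
      (Smoothing.smoothingMeasure d (k d) (σ d)).real {z | M < ‖z‖} ≤ η)
    (hmode : ∀ᶠ d in atTop,
      Smoothing.IsMode ((Smoothing.smoothingMeasure d (k d) (σ d)).map (fun z => ‖z‖)) (C * r)) :
    (∀ ε : ℝ, 0 < ε → ε < 1 → ∃ t : ℝ, 1 < t ∧ ∃ d₀ : ℕ,
      (∀ lam : ℝ, 0 ≤ lam → ∃ K : ℝ, ∀ d ≥ d₀, ∀ x : Fin d → ℝ,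
        (1 - ε) * (lam - K / t ^ d) ≤
          Smoothing.maxDiscrepancy (Smoothing.unitFunctions d) (Smoothing.linftyBall d r) x lam
            (Smoothing.smoothingMeasure d (k d) (σ d))) ∧
      (∃ K : ℝ, ∀ d ≥ d₀, ∀ x : Fin d → ℝ, ∀ g ∈ Smoothing.unitFunctions d,
        Smoothing.smoothed (Smoothing.smoothingMeasure d (k d) (σ d)) g x ≤ 1 - ε →
          Smoothing.certificationBound (Smoothing.unitFunctions d) (Smoothing.linftyBall d r)
              (Smoothing.smoothingMeasure d (k d) (σ d)) g x ≤ K / t ^ d ∧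
          Smoothing.certificationBound (Smoothing.unitFunctions d) (Smoothing.linftyBall d r)
              (Smoothing.smoothingMeasure d (k d) (σ d)) g x < 1 / 2)) ∧
    (∀ lam : ℝ, 0 ≤ lam → ∀ x : (d : ℕ) → Fin d → ℝ,
      Tendsto (fun d => Smoothing.maxDiscrepancy (Smoothing.unitFunctions d)
          (Smoothing.linftyBall d r) (x d) lam (Smoothing.smoothingMeasure d (k d) (σ d)))
        atTop (𝓝 lam)) := by
  have hab : ∀ ε : ℝ, 0 < ε → ε < 1 → ∃ t : ℝ, 1 < t ∧ ∃ d₀ : ℕ,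
      (∀ lam : ℝ, 0 ≤ lam → ∃ K : ℝ, ∀ d ≥ d₀, ∀ x : Fin d → ℝ,
        (1 - ε) * (lam - K / t ^ d) ≤
          Smoothing.maxDiscrepancy (Smoothing.unitFunctions d) (Smoothing.linftyBall d r) x lam
            (Smoothing.smoothingMeasure d (k d) (σ d))) ∧
      (∃ K : ℝ, ∀ d ≥ d₀, ∀ x : Fin d → ℝ, ∀ g ∈ Smoothing.unitFunctions d,
        Smoothing.smoothed (Smoothing.smoothingMeasure d (k d) (σ d)) g x ≤ 1 - ε →
          Smoothing.certificationBound (Smoothing.unitFunctions d) (Smoothing.linftyBall d r)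
              (Smoothing.smoothingMeasure d (k d) (σ d)) g x ≤ K / t ^ d ∧
          Smoothing.certificationBound (Smoothing.unitFunctions d) (Smoothing.linftyBall d r)
              (Smoothing.smoothingMeasure d (k d) (σ d)) g x < 1 / 2) := by
    intro ε hε hε1
    obtain ⟨t, ht, hev⟩ := Smoothing.exists_separating_sets hr hparam hbounded hε
    have htlim : ∀ᶠ d : ℕ in atTop, 1 / t ^ d < 1 / 2 := by
      have h := (tendsto_pow_atTop_nhds_zero_of_lt_one (inv_nonneg.2 (zero_le_one.trans ht.le))
        (inv_lt_one_of_one_lt₀ ht)).eventually_lt_const (show (0 : ℝ) < 1 / 2 by norm_num)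
      simpa only [inv_pow, one_div] using h
    obtain ⟨d₀, hd₀⟩ := eventually_atTop.1 (hev.and htlim)
    -- K = 1/(1 - ε) cancels the outer factor, leaving λ(1 - ε) - t^(-d).
    refine ⟨t, ht, d₀, fun lam hlam => ⟨1 / (1 - ε), fun d hd x => ?_⟩,
      1, fun d hd x g hg hgx => ?_⟩
    · obtain ⟨⟨hprob, A, hA, δ, hδ, h1, h2⟩, -⟩ := hd₀ d hd
      refine le_trans ?_ (Smoothing.le_maxDiscrepancy hlam x hδ hA)
      have h3 : (1 - ε) * (lam - 1 / (1 - ε) / t ^ d) = lam * (1 - ε) - 1 / t ^ d := by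
        have : 1 - ε ≠ 0 := by linarith
        field_simp
      rw [h3]
      have := mul_le_mul_of_nonneg_left h1 hlam
      linarith
    · obtain ⟨⟨hprob, A, hA, δ, hδ, h1, h2⟩, h3⟩ := hd₀ d hd
      have hApos : 0 < (Smoothing.smoothingMeasure d (k d) (σ d)).real A := by linarith
      have hle := Smoothing.certificationBound_le hg x hδ hA hApos (hgx.trans h1)
      have hle' := hle.trans (mul_le_of_le_one_left measureReal_nonneg
        ((div_le_one hApos).2 (hgx.trans h1)))
      exact ⟨hle'.trans h2, (hle'.trans h2).trans_lt h3⟩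
  refine ⟨hab, fun lam hlam x => ?_⟩
  refine tendsto_order.2 ⟨fun a ha => ?_, fun a ha => ?_⟩
  · rcases hlam.eq_or_lt with rfl | hlam'
    · filter_upwards [hparam] with d ⟨_, _, hprob⟩
      refine ha.trans_le (le_trans (by simp) (Smoothing.le_maxDiscrepancy le_rfl (x d)
        (Smoothing.const_mem_linftyBall d hr.le) MeasurableSet.empty))
    · obtain ⟨ε, hε, hε1, hεa⟩ : ∃ ε : ℝ, 0 < ε ∧ ε < 1 ∧ a < (1 - ε) * lam := by
        have hmax : max a 0 / lam < 1 := (div_lt_one hlam').2 (max_lt ha hlam')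
        have hmax0 : 0 ≤ max a 0 / lam := by positivity
        -- This puts (1 - ε)λ midway between max(a, 0) and λ.
        refine ⟨(1 - max a 0 / lam) / 2, by linarith, by linarith, ?_⟩
        have h1 : max a 0 / lam * lam = max a 0 := div_mul_cancel₀ _ hlam'.ne'
        have h2 : max a 0 < lam := max_lt ha hlam'
        have h3 := le_max_left a 0
        linarith
      obtain ⟨t, ht, d₀, h, -⟩ := hab ε hε hε1
      obtain ⟨K, hK⟩ := h lam hlam
      have hlim : Tendsto (fun d : ℕ => (1 - ε) * (lam - K / t ^ d)) atTop
          (𝓝 ((1 - ε) * (lam - 0))) :=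
        (tendsto_const_nhds.sub (tendsto_const_nhds.div_atTop
          (tendsto_pow_atTop_atTop_of_one_lt ht))).const_mul _
      rw [sub_zero] at hlim
      filter_upwards [hlim.eventually_const_lt hεa, eventually_ge_atTop d₀] with d hd hd0
      exact hd.trans_le (hK d hd0 (x d))
  · filter_upwards [hparam] with d ⟨_, _, hprob⟩
    exact (Smoothing.maxDiscrepancy_le hlam (x d) _).trans_lt ha
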